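/- **Model.** Let $T\ge 1$, $\mu,q\in[0,1]$, $c>0$. A two-state Markov chain $s_1,\dots,s_T$ starts in the good state $g$ with probability $\mu$, moves from $g$ to the bad state $b$ with probability $q$ at each of the times $2,\dots,T$, and never leaves $b$. Let $\theta\in\{1,\dots,T+1\}$ be the time of the jump ($\theta=T+1$ if the chain stays good), so that $\mathbb P(\theta=1)=1-\mu$, $\mathbb P(\theta=j)=\mu(1-q)^{j-2}q$ for $2\le j\le T$, $\mathbb P(\theta=T+1)=\mu(1-q)^{T-1}$, and $s_t=g$ iff $\theta>t$. A detector who does not observe the chain declares the jump at a time $\tau\in\{1,\dots,T+1\}$ ($\tau=T+1$ means never) at cost $J^D(\tau,\theta)=1_{\{\tau<\theta\}}+c(\tau-\theta)1_{\{\tau\ge\theta\}}$. A principal who observes the chain commits to a direct mechanism $\rho$: at time $t$, given $\theta_t=\min(\theta,t+1)$ and the past messages $m_{1:t-1}\in\{k,d\}^{t-1}$, he sends $m_t=k$ ("keep silent") with probability $\rho_t^{\theta_t,m_{1:t-1}}\in[0,1]$ and $m_t=d$ ("declare") otherwise. The mechanism is *obedient* if for every $t\in\{1,\dots,T\}$,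 conditional on $m_{1:t}=(k)^t$ (respectively on $m_{1:t}=((k)^{t-1},d)$), whenever this event has positive probability, the expected continuation cost from time $t$ on of keeping silent at $t$ and following the recommendations from $t+1$ on is at most (respectively at least) that of declaring at $t$; here delay costs incurred before $t$ are not counted. Problem (P) is to maximize the principal's expected utility $\mathbb E^\rho[\tau-1]$ over obedient direct mechanisms, where $\tau$ is the first time at which $d$ is sent ($T+1$ if there is none). A mechanism is *time-based prioritized* if $\rho_t$ depends only on $s_t$ and $m_{1:t-1}$, $\rho_t^{g,m_{1:t-1}}=1$ for all $t$ and $m_{1:t-1}$, and there is no $t$ with $1\le t<T$, $\rho_{t+1}^{b,(k)^t}>0$ and $\rho_t^{b,(k)^{t-1}}<1$. Given the dependence only on $s_t,m_{1:t-1}$ and $\rho_t^{g,m_{1:t-1}}=1$, it is *described by* a pair $(n_p,q_{n_p})$ with $n_p\in\{1,\dots,T\}$, $q_{n_p}\in[0,1]$, if $\rho_t^{b,(k)^{t-1}}$ equals $1$ for $t<n_p$, $q_{n_p}$ for $t=n_p$, and $0$ for $t>n_p$. **Algorithm 1.** For $n=1,\dots,T$ compute $$q_n=\min_{1\le t\le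 n}\frac{1}{\mathbb P(\theta\le n)}\Big(\frac{\mathbb P(\theta>t)}{c}-\sum_{l=t}^{n-1}\mathbb P(\theta\le l)\Big)$$ (read as $+\infty$ if $\mathbb P(\theta\le n)=0$), and stop at the first $n$ with $q_n<1$, or at $n=T$ if there is none. Return $n_p^*=n$ and $q_{n_p}^*=\min\{q_n,1\}$. **Theorem 1.** 1. For every obedient direct mechanism there is an obedient time-based prioritized mechanism with at least the same expected utility of the principal, and Problem (P) has an optimal solution that is time-based prioritized. The time-based prioritized mechanisms are exactly those described by some pair $(n_p,q_{n_p})$, and each such pair describes a mechanism. 2. An obedient mechanism described by a pair that maximizes $n_p+q_{n_p}$ among all pairs describing an obedient mechanism is optimal for (P). Conversely, if $\mu<1$, or if $0<q<1$ and $T\ge2$, then every mechanism that is described by a pair and is optimal for (P) has a pair that maximizes $n_p+q_{n_p}$ among all pairs describing an obedient mechanism. 3. The pair $(n_p^*,q_{n_p}^*)$ returned by Algorithm 1 satisfies $1\le n_p^*\le T$ and $0\le q_{n_p}^*\le1$ and maximizes $n_p+q_{n_p}$ among all pairs describing an obedient mechanism. Every mechanism $\rho^*$ described by it is time-based prioritized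 and optimal for (P), and $$\mathbb E^{\rho^*}[\tau-1]=n_p^*-1+\mathbb P(\theta\le n_p^*)\,q_{n_p}^*+\sum_{t=n_p^*}^{T}\mathbb P(\theta>t).$$ -/

import Mathlib

open scoped BigOperators

namespace InfoDesign

/-- The two messages (recommendations) of a direct mechanism:
`silent` (keep silent, `k`) and `declare` (declare the jump, `d`). -/
inductive Message where
  | silent : Message
  | declare : Message
deriving DecidableEq

instance : Fintype Message where
  elems := {Message.silent, Message.declare}
  complete := fun x => by cases x <;> simp

/-- The law of the jump time `θ ∈ {1, …, T + 1}` of the two-state chain that starts in the good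
state with probability `μ`, moves from good to bad with probability `q` at each of the times
`2, …, T`, and never leaves the bad state. `θ = T + 1` means that the chain stays good up to time
`T`. The state at time `t` is good if and only if `t < θ`. -/
noncomputable def jumpProb (T : ℕ) (μ q : ℝ) (θ : ℕ) : ℝ :=
  if θ = 1 then 1 - μ
  else if 2 ≤ θ ∧ θ ≤ T then μ * (1 - q) ^ (θ - 2) * q
  else if θ = T + 1 then μ * (1 - q) ^ (T - 1)
  else 0

/-- `P(θ ≤ t)`. -/
noncomputable def probLE (T : ℕ) (μ q : ℝ) (t : ℕ) : ℝ :=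
  ∑ θ ∈ (Finset.Icc 1 (T + 1)).filter (fun θ => θ ≤ t), jumpProb T μ q θ

/-- `P(θ > t)`. -/
noncomputable def probGT (T : ℕ) (μ q : ℝ) (t : ℕ) : ℝ :=
  ∑ θ ∈ (Finset.Icc 1 (T + 1)).filter (fun θ => t < θ), jumpProb T μ q θ

/-- A direct mechanism (recommendation policy). For a list `h` of past messages `m₁, …, m_{t-1}`
(so the current time is `t = h.length + 1`) and a value `θ_t = min θ (t + 1) ∈ {1, …, t + 1}`,
`silence θ_t h` is the probability of sending the message `silent` at time `t`.
Only lists of length less than the horizon play a role. -/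
structure Mechanism where
  silence : ℕ → List Message → ℝ
  silence_nonneg : ∀ s h, 0 ≤ silence s h
  silence_le_one : ∀ s h, silence s h ≤ 1

/-- The probability that the message after the history `h` is `x`, when the jump time is `θ`. -/
noncomputable def Mechanism.msgProb (ρ : Mechanism) (θ : ℕ) (h : List Message) (x : Message) : ℝ :=
  match x with
  | Message.silent => ρ.silence (min θ (h.length + 2)) h
  | Message.declare => 1 - ρ.silence (min θ (h.length + 2)) h

/-- The list of the first `i` messages of a message path `m`; `m i` is the message of time
`i + 1`. -/
def history {T : ℕ} (m : Fin T → Message) (i : ℕ) : List Message :=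
  (List.ofFn m).take i

/-- The joint probability that the jump time is `θ` and the message path is `m`. -/
noncomputable def pathProb (T : ℕ) (μ q : ℝ) (ρ : Mechanism) (θ : ℕ) (m : Fin T → Message) : ℝ :=
  jumpProb T μ q θ * ∏ i : Fin T, ρ.msgProb θ (history m i) (m i)

/-- Expectation of a function of the jump time and the message path, under the mechanism `ρ`. -/
noncomputable def expect (T : ℕ) (μ q : ℝ) (ρ : Mechanism)
    (f : ℕ → (Fin T → Message) → ℝ) : ℝ :=
  ∑ θ ∈ Finset.Icc 1 (T + 1), ∑ m : Fin T → Message, pathProb T μ q ρ θ m * f θ m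

open Classical in
/-- The probability of an event `A` about the message path. -/
noncomputable def prob (T : ℕ) (μ q : ℝ) (ρ : Mechanism) (A : Set (Fin T → Message)) : ℝ :=
  expect T μ q ρ (fun _ m => if m ∈ A then 1 else 0)

open Classical in
/-- Expectation conditional on an event `A` about the message path (only used if `A` has positive
probability). -/
noncomputable def condExpect (T : ℕ) (μ q : ℝ) (ρ : Mechanism) (A : Set (Fin T → Message))
    (f : ℕ → (Fin T → Message) → ℝ) : ℝ :=
  expect T μ q ρ (fun θ m => if m ∈ A then f θ m else 0) / prob T μ q ρ A

/-- The declaration time of a detector who is silent before time `t` and follows the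
recommendations `m` from time `t` on: the first time `l ≥ t` at which `declare` is recommended,
and `T + 1` if there is none (`1 ≤ t ≤ T + 1`). -/
noncomputable def obeyTime {T : ℕ} (m : Fin T → Message) (t : ℕ) : ℕ :=
  sInf {l : ℕ | t ≤ l ∧ (l = T + 1 ∨ ∃ i : Fin T, (i : ℕ) + 1 = l ∧ m i = Message.declare)}

/-- The detector's cost of declaring at time `τ`: one unit for a false alarm, `c` per unit of
delay. -/
noncomputable def detectorCost (c : ℝ) (τ θ : ℕ) : ℝ :=
  if τ < θ then 1 else c * ((τ : ℝ) - (θ : ℝ))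

/-- The detector's continuation cost from time `t` on: the cost without the delay cost
`c * max (t - θ) 0` that was incurred before time `t` (natural subtraction truncates). -/
noncomputable def contCost (c : ℝ) (t τ θ : ℕ) : ℝ :=
  detectorCost c τ θ - c * ((t - θ : ℕ) : ℝ)

/-- The event `m₁ = ⋯ = m_t = silent`. -/
def silentUpTo (T t : ℕ) : Set (Fin T → Message) :=
  {m | ∀ i : Fin T, (i : ℕ) + 1 ≤ t → m i = Message.silent}

/-- The event `m₁ = ⋯ = m_{t-1} = silent`, `m_t = declare`. -/
def firstDeclareAt (T t : ℕ) : Set (Fin T → Message) :=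
  {m | (∀ i : Fin T, (i : ℕ) + 1 < t → m i = Message.silent) ∧
    ∀ i : Fin T, (i : ℕ) + 1 = t → m i = Message.declare}

/-- The obedience constraints: at each time `t`, after each history of positive probability in
which `declare` was not recommended before time `t`, following the current recommendation costs
the detector in expectation no more than the other action, given that she obeys afterwards. -/
def Obedient (T : ℕ) (μ q c : ℝ) (ρ : Mechanism) : Prop :=
  ∀ t : ℕ, 1 ≤ t → t ≤ T →
    (0 < prob T μ q ρ (silentUpTo T t) →
      condExpect T μ q ρ (silentUpTo T t) (fun θ m => contCost c t (obeyTime m (t + 1)) θ) ≤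
        condExpect T μ q ρ (silentUpTo T t) (fun θ _ => contCost c t t θ)) ∧
    (0 < prob T μ q ρ (firstDeclareAt T t) →
      condExpect T μ q ρ (firstDeclareAt T t) (fun θ _ => contCost c t t θ) ≤
        condExpect T μ q ρ (firstDeclareAt T t)
          (fun θ m => contCost c t (obeyTime m (t + 1)) θ))

/-- The principal's expected utility `E[τ - 1]` when the detector follows the recommendations. -/
noncomputable def utility (T : ℕ) (μ q : ℝ) (ρ : Mechanism) : ℝ :=
  expect T μ q ρ (fun _ m => (obeyTime m 1 : ℝ) - 1)

/-- `ρ` solves the principal's problem: it is obedient and has the largest expected utility of all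
obedient direct mechanisms. -/
def IsOptimal (T : ℕ) (μ q c : ℝ) (ρ : Mechanism) : Prop :=
  Obedient T μ q c ρ ∧
    ∀ ρ' : Mechanism, Obedient T μ q c ρ' → utility T μ q ρ' ≤ utility T μ q ρ

/-- The recommendation of `ρ` depends only on the past messages and the current state: all values
`θ_t ≤ t` (bad state at time `t = h.length + 1`) give the same probability. -/
def StateOnly (T : ℕ) (ρ : Mechanism) : Prop :=
  ∀ h : List Message, h.length < T → ∀ s s' : ℕ, 1 ≤ s → s ≤ h.length + 1 →
    1 ≤ s' → s' ≤ h.length + 1 → ρ.silence s h = ρ.silence s' h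

/-- Probability of recommending silence after the history `h` if the current state is good. -/
def Mechanism.good (ρ : Mechanism) (h : List Message) : ℝ := ρ.silence (h.length + 2) h

/-- Probability of recommending silence after the history `h` if the current state is bad, for a
mechanism that depends only on the current state and the past messages. -/
def Mechanism.bad (ρ : Mechanism) (h : List Message) : ℝ := ρ.silence 1 h

/-- The history of `n` messages that are all `silent`. -/
def silentHistory (n : ℕ) : List Message := List.replicate n Message.silent

/-- Time-based prioritized mechanisms. -/
def TimePrioritized (T : ℕ) (ρ : Mechanism) : Prop :=
  StateOnly T ρ ∧
  (∀ h : List Message, h.length < T → ρ.good h = 1) ∧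
  ¬ ∃ t : ℕ, 1 ≤ t ∧ t + 1 ≤ T ∧
    0 < ρ.bad (silentHistory t) ∧ ρ.bad (silentHistory (t - 1)) < 1

/-- `ρ` is a mechanism described by the pair `(n, r)`: in the good state it always recommends
silence; in the bad state, as long as only `silent` has been sent, it recommends silence before
time `n`, with probability `r` at time `n`, and never after time `n`. -/
def HasThreshold (T : ℕ) (ρ : Mechanism) (n : ℕ) (r : ℝ) : Prop :=
  StateOnly T ρ ∧
  (∀ h : List Message, h.length < T → ρ.good h = 1) ∧
  ∀ t : ℕ, 1 ≤ t → t ≤ T →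
    ρ.bad (silentHistory (t - 1)) = if t < n then 1 else if t = n then r else 0

/-- The admissible pairs `(n, r)`: `n ∈ {1, …, T}` and `r ∈ [0, 1]`. -/
def ValidPair (T n : ℕ) (r : ℝ) : Prop := 1 ≤ n ∧ n ≤ T ∧ 0 ≤ r ∧ r ≤ 1

/-- The value computed in round `n` of the algorithm, a minimum over `t = 1, …, n`. The quotient
is read as `+∞` if `P(θ ≤ n) = 0`. -/
noncomputable def roundValue (T : ℕ) (μ q c : ℝ) (n : ℕ) : EReal :=
  (Finset.Icc 1 n).inf fun t =>
    if probLE T μ q n = 0 then (⊤ : EReal)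
    else ((1 / probLE T μ q n *
      (probGT T μ q t / c - ∑ l ∈ Finset.Ico t n, probLE T μ q l) : ℝ) : EReal)

/-- The loop of the algorithm from round `n` on, with `k` rounds left after round `n`: it stops in
the first round whose value is less than `1`, or in the last round. -/
noncomputable def algorithmLoop (T : ℕ) (μ q c : ℝ) : ℕ → ℕ → ℕ × EReal
  | 0, n => (n, roundValue T μ q c n)
  | k + 1, n =>
    open Classical in
    if roundValue T μ q c n < 1 then (n, roundValue T μ q c n)
    else algorithmLoop T μ q c k (n + 1)

/-- The threshold `n*` returned by the algorithm, which runs through the rounds `1, …, T`. -/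
noncomputable def algThreshold (T : ℕ) (μ q c : ℝ) : ℕ :=
  (algorithmLoop T μ q c (T - 1) 1).1

/-- The probability `q*` returned by the algorithm: the value of the round `n*`, and `1` if that
value exceeds `1` (which can happen only if the loop ends without a break). -/
noncomputable def algProb (T : ℕ) (μ q c : ℝ) : ℝ :=
  (min (algorithmLoop T μ q c (T - 1) 1).2 1).toReal

end InfoDesign

open InfoDesign

/-! ### Silence probabilities along message paths -/

namespace InfoDesign

/-! Everything reduces to a small linear program. Let `F l = P(θ ≤ l)`, `G l = P(θ > l)`, and let `B
l` (`silentBad`) be the probability that the jump has occurred by `l` and the first `l` messages are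
silent. Counting periods one by one, the silence constraint at `t` reads `c * ∑_{l=t}^T B l ≤
silentJump t`, with right side at most `G t` (`expect_gain`, `Obedient.silent_le`), and the utility
is at most `∑ B l + ∑ G l` (`utility_le`). So every obedient mechanism gives a point of the
relaxation: maximize `∑ B l` subject to `B l ≤ F l` and `c * ∑_{l=t}^T B l ≤ G t`.

A threshold mechanism never declares in the good state, which makes both bounds equalities and the
declare constraints automatic. Its `B` is front-loaded: `F l` before `n`, `r * F n` at `n`, then
zero. Front-loading is best because the constraints bound tail sums only.

The algorithm either ends at `(T, 1)`, where `B = F`, or makes the constraint at some `t` tight. In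
the second case any competitor has at most `∑ F l` before `t` and at most the tight tail from `t`
on, so the returned pair solves the relaxation (`sum_le_silentValue_algorithm`). The value of a pair
is monotone in `n + r`, strictly so where `F n > 0`, which gives the statements about maximizing
pairs. -/

lemma sum_message (f : Message → ℝ) : ∑ x, f x = f .silent + f .declare := by
  have : (Finset.univ : Finset Message) = {Message.silent, Message.declare} := rfl
  rw [this, Finset.sum_pair (by decide)]

open Classical in
/-- The indicator of the event that the first `l` messages are silent. -/
noncomputable def silentInd {T : ℕ} (m : Fin T → Message) (l : ℕ) : ℝ :=
  if m ∈ silentUpTo T l then 1 else 0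

lemma history_cons {T : ℕ} (x : Message) (m : Fin T → Message) (i : ℕ) :
    history (Fin.cons x m : Fin (T + 1) → Message) (i + 1) = x :: history m i := by
  simp [history, List.ofFn_succ]

lemma history_zero {T : ℕ} (m : Fin T → Message) : history m 0 = [] := by
  simp [history]

lemma sum_paths_succ {T : ℕ} (f : (Fin (T + 1) → Message) → ℝ) :
    ∑ m, f m = ∑ x, ∑ m : Fin T → Message, f (Fin.cons x m) := by
  rw [← Fintype.sum_prod_type']
  exact (Fintype.sum_equiv (Fin.consEquiv fun _ => Message) _ _ fun p => rfl).symm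

lemma silentInd_zero {T : ℕ} (m : Fin T → Message) : silentInd m 0 = 1 := by
  simp [silentInd, silentUpTo]

lemma silentInd_cons_silent {T : ℕ} (m : Fin T → Message) (l : ℕ) :
    silentInd (Fin.cons .silent m : Fin (T + 1) → Message) (l + 1) = silentInd m l := by
  simp [silentInd, silentUpTo, Fin.forall_fin_succ]

lemma silentInd_cons_declare {T : ℕ} (m : Fin T → Message) (l : ℕ) :
    silentInd (Fin.cons .declare m : Fin (T + 1) → Message) (l + 1) = 0 := by
  simp [silentInd, silentUpTo, Fin.forall_fin_succ]

/-- The probability that the first `l` messages are silent, when messages are drawn from a kernel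
that takes the past messages into account. -/
lemma sum_paths_silentInd (T : ℕ) : ∀ (K : List Message → Message → ℝ)
    (_ : ∀ h, K h .silent + K h .declare = 1) (l : ℕ) (_ : l ≤ T),
    ∑ m : Fin T → Message, (∏ i : Fin T, K (history m i) (m i)) * silentInd m l =
      ∏ i ∈ Finset.range l, K (silentHistory i) .silent := by
  induction T with
  | zero =>
    intro K hK l hl
    obtain rfl : l = 0 := by omega
    simp [silentInd_zero]
  | succ T ih =>
    intro K hK l hl
    -- Peeling off the first message leaves a shorter path driven by the kernel shifted by that
    -- message; hence the induction over all kernels.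
    have step : ∀ x (m : Fin T → Message),
        ∏ i : Fin (T + 1), K (history (Fin.cons x m : Fin (T + 1) → Message) i)
          ((Fin.cons x m : Fin (T + 1) → Message) i) =
        K [] x * ∏ i : Fin T, K (x :: history m i) (m i) := by
      intro x m
      rw [Fin.prod_univ_succ]
      simp [history_cons, history_zero]
    rw [sum_paths_succ, sum_message]
    simp only [step]
    cases l with
    | zero =>
      have key : ∀ x, ∑ m : Fin T → Message, ∏ i : Fin T, K (x :: history m i) (m i) = 1 := by
        intro x
        simpa [silentInd_zero] using ih (fun h => K (x :: h)) (fun h => hK _) 0 (Nat.zero_le _)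
      simp only [silentInd_zero, mul_one, ← Finset.mul_sum, key, hK, Finset.range_zero,
        Finset.prod_empty]
    | succ l =>
      have key := ih (fun h => K (.silent :: h)) (fun h => hK _) l (by omega)
      simp only [silentInd_cons_silent, silentInd_cons_declare, mul_zero, Finset.sum_const_zero,
        add_zero, mul_assoc, ← Finset.mul_sum, key]
      rw [Finset.prod_range_succ']
      simp [silentHistory, List.replicate_succ, mul_comm]

/-- The probability that the first `l` messages are silent, given the jump time `θ`. -/
noncomputable def Mechanism.surv (ρ : Mechanism) (θ l : ℕ) : ℝ :=
  ∏ i ∈ Finset.range l, ρ.silence (min θ (i + 2)) (silentHistory i)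

lemma Mechanism.surv_nonneg (ρ : Mechanism) (θ l : ℕ) : 0 ≤ ρ.surv θ l :=
  Finset.prod_nonneg fun _ _ => ρ.silence_nonneg _ _

lemma Mechanism.surv_le_one (ρ : Mechanism) (θ l : ℕ) : ρ.surv θ l ≤ 1 :=
  Finset.prod_le_one (fun _ _ => ρ.silence_nonneg _ _) fun _ _ => ρ.silence_le_one _ _

lemma Mechanism.surv_antitone (ρ : Mechanism) (θ : ℕ) : Antitone (ρ.surv θ) := by
  refine antitone_nat_of_succ_le fun l => ?_
  rw [Mechanism.surv, Finset.prod_range_succ]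
  exact mul_le_of_le_one_right (ρ.surv_nonneg θ l) (ρ.silence_le_one _ _)

lemma sum_msgProb_silentInd {T : ℕ} (ρ : Mechanism) (θ l : ℕ) (hl : l ≤ T) :
    ∑ m : Fin T → Message, (∏ i : Fin T, ρ.msgProb θ (history m i) (m i)) * silentInd m l =
      ρ.surv θ l := by
  rw [sum_paths_silentInd T (ρ.msgProb θ) (fun h => by simp [Mechanism.msgProb]) l hl]
  simp [Mechanism.msgProb, Mechanism.surv, silentHistory]

lemma Mechanism.msgProb_nonneg (ρ : Mechanism) (θ : ℕ) (h : List Message) (x : Message) :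
    0 ≤ ρ.msgProb θ h x := by
  cases x
  · exact ρ.silence_nonneg _ _
  · exact sub_nonneg.2 (ρ.silence_le_one _ _)

/-! ### Declaration time and continuation cost -/

/-- The defining set contains `T + 1`, so its infimum is attained. The last clause translates
statements about the stopping time into silence indicators. -/
lemma obeyTime_spec {T : ℕ} (m : Fin T → Message) {t : ℕ} (ht : t ≤ T + 1) :
    t ≤ obeyTime m t ∧ obeyTime m t ≤ T + 1 ∧ ∀ l, l ≤ T →
      (l < obeyTime m t ↔ ∀ i : Fin T, t ≤ (i : ℕ) + 1 → (i : ℕ) + 1 ≤ l → m i = .silent) := by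
  have hmem : T + 1 ∈ {l : ℕ | t ≤ l ∧ (l = T + 1 ∨ ∃ i : Fin T, (i : ℕ) + 1 = l ∧
      m i = Message.declare)} := ⟨ht, Or.inl rfl⟩
  have hs := Nat.sInf_mem ⟨_, hmem⟩
  refine ⟨hs.1, Nat.sInf_le hmem, fun l hl => ⟨fun h i h1 h2 => ?_, fun h => ?_⟩⟩
  · by_contra hne
    have hd : m i = .declare := by
      cases hmi : m i
      · exact absurd hmi hne
      · rfl
    have : obeyTime m t ≤ (i : ℕ) + 1 := Nat.sInf_le ⟨h1, Or.inr ⟨i, rfl, hd⟩⟩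
    omega
  · by_contra hlt
    change t ≤ obeyTime m t ∧ (obeyTime m t = T + 1 ∨ ∃ i : Fin T, (i : ℕ) + 1 = obeyTime m t ∧
      m i = Message.declare) at hs
    obtain ⟨h1, h2 | ⟨i, hi, hd⟩⟩ := hs
    · omega
    · have := h i (by omega) (by omega)
      rw [this] at hd
      cases hd

/-- On the event that the messages before time `t` are silent, the detector who obeys from time
`t` on is still silent at time `l` exactly when the first `l` messages are silent. -/
lemma silentInd_eq_of_mem {T : ℕ} {m : Fin T → Message} {t l : ℕ}
    (hm : m ∈ silentUpTo T t) (ht : t ≤ T) (hl : l ≤ T) :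
    silentInd m l = if l < obeyTime m (t + 1) then 1 else 0 := by
  have := (obeyTime_spec m (t := t + 1) (by omega)).2.2 l hl
  classical
  unfold silentInd
  refine if_congr ?_ rfl rfl
  rw [this]
  refine ⟨fun h i _ h2 => h i h2, fun h i h2 => ?_⟩
  by_cases hi : (i : ℕ) + 1 ≤ t
  · exact hm i hi
  · exact h i (by omega) h2

lemma silentInd_eq_zero {T : ℕ} {m : Fin T → Message} {t l : ℕ}
    (hm : m ∉ silentUpTo T t) (_ : t ≤ l) : silentInd m l = 0 := by
  classical
  exact if_neg fun h => hm fun i hi => h i (by omega)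

/-- Layer-cake formula: `τ - 1` counts the times `l` in `1, …, T` with `l < τ`. -/
lemma obeyTime_one_sub_one {T : ℕ} (m : Fin T → Message) :
    (obeyTime m 1 : ℝ) - 1 = ∑ l ∈ Finset.Icc 1 T, silentInd m l := by
  have h0 : m ∈ silentUpTo T 0 := fun i hi => by omega
  obtain ⟨h1, h2, -⟩ := obeyTime_spec m (t := 1) (by omega)
  rw [Finset.sum_congr rfl fun l hl => silentInd_eq_of_mem h0 (Nat.zero_le T)
    (Finset.mem_Icc.1 hl).2, Finset.sum_boole]
  have : (Finset.Icc 1 T).filter (fun l => l < obeyTime m (0 + 1)) =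
      Finset.Ico 1 (obeyTime m 1) := by
    ext l; simp only [Finset.mem_filter, Finset.mem_Icc, Finset.mem_Ico, zero_add]; omega
  rw [this, Nat.card_Ico, Nat.cast_sub h1, Nat.cast_one]

lemma contCost_self (c : ℝ) (t θ : ℕ) : contCost c t t θ = if t < θ then 1 else 0 := by
  unfold contCost detectorCost
  split_ifs with h
  · rw [Nat.sub_eq_zero_of_le h.le]; simp
  · rw [Nat.cast_sub (not_lt.1 h)]; ring

lemma contCost_eq (c : ℝ) {t τ θ : ℕ} (h : t < τ) :
    contCost c t τ θ = if τ < θ then 1 else c * ((τ : ℝ) - (max t θ : ℕ)) := by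
  unfold contCost detectorCost
  split_ifs with h1
  · rw [Nat.sub_eq_zero_of_le (by omega)]; simp
  · rcases le_total t θ with h2 | h2
    · rw [Nat.sub_eq_zero_of_le h2, max_eq_right h2]; simp
    · rw [Nat.cast_sub h2, max_eq_left h2]; ring

open Classical in
/-- The gain from obeying the recommendation of silence at time `t` instead of declaring. -/
lemma gain_eq {T : ℕ} (c : ℝ) (m : Fin T → Message) {t θ : ℕ} (ht : t ≤ T)
    (hθ : θ ≤ T + 1) :
    (if m ∈ silentUpTo T t then contCost c t t θ else 0) -
      (if m ∈ silentUpTo T t then contCost c t (obeyTime m (t + 1)) θ else 0) =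
    (if t < θ then silentInd m (θ - 1) else 0) -
      c * ∑ l ∈ Finset.Icc t T, if θ ≤ l then silentInd m l else 0 := by
  by_cases hm : m ∈ silentUpTo T t
  · obtain ⟨h1, h2, -⟩ := obeyTime_spec m (t := t + 1) (by omega)
    -- The sum counts the periods of delay from `max t θ` until the declaration; truncated
    -- subtraction gives zero for a false alarm.
    have hsum : ∑ l ∈ Finset.Icc t T, (if θ ≤ l then silentInd m l else 0) =
        ((obeyTime m (t + 1) - max t θ : ℕ) : ℝ) := by
      rw [Finset.sum_congr rfl fun l hl => by
        rw [silentInd_eq_of_mem hm ht (Finset.mem_Icc.1 hl).2]]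
      simp only [← ite_and]
      rw [Finset.sum_boole]
      have : (Finset.Icc t T).filter (fun l => θ ≤ l ∧ l < obeyTime m (t + 1)) =
          Finset.Ico (max t θ) (obeyTime m (t + 1)) := by
        ext l; simp only [Finset.mem_filter, Finset.mem_Icc, Finset.mem_Ico]; omega
      rw [this, Nat.card_Ico]
    rw [hsum, if_pos hm, if_pos hm, contCost_self, contCost_eq c (by omega)]
    -- If the obedient detector also declares before the jump, both actions are false alarms of cost
    -- one.
    by_cases h3 : obeyTime m (t + 1) < θ
    · rw [silentInd_eq_of_mem hm ht (by omega), Nat.sub_eq_zero_of_le (show obeyTime m (t + 1) ≤ max t θ by omega)]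
      simp only [if_pos h3, if_pos (show t < θ by omega),
        if_neg (show ¬ θ - 1 < obeyTime m (t + 1) by omega)]
      simp
    · rw [Nat.cast_sub (by omega)]
      by_cases h4 : t < θ
      · rw [silentInd_eq_of_mem hm ht (by omega)]
        simp only [if_pos h4, if_neg h3, if_pos (show θ - 1 < obeyTime m (t + 1) by omega)]
      · simp only [if_neg h4, if_neg h3]
  · rw [if_neg hm, if_neg hm, Finset.sum_eq_zero, mul_zero]
    · by_cases h4 : t < θ
      · rw [if_pos h4, silentInd_eq_zero hm (by omega)]
      · rw [if_neg h4]
    · intro l hl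
      rw [silentInd_eq_zero hm (Finset.mem_Icc.1 hl).1, ite_self]

/-! ### Law of the jump time -/

section law
variable {T : ℕ} {μ q : ℝ}

lemma jumpProb_nonneg (hμ0 : 0 ≤ μ) (hμ1 : μ ≤ 1) (hq0 : 0 ≤ q) (hq1 : q ≤ 1) (θ : ℕ) :
    0 ≤ jumpProb T μ q θ := by
  have h1 : 0 ≤ 1 - q := by linarith
  have h2 : 0 ≤ 1 - μ := by linarith
  unfold jumpProb
  split_ifs <;> positivity

lemma sum_jumpProb (hT : 1 ≤ T) : ∑ θ ∈ Finset.Icc 1 (T + 1), jumpProb T μ q θ = 1 := by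
  -- The partial sums telescope: `μ * (1 - q) ^ n` is the probability of still being good at time `n
  -- + 1`.
  have key : ∀ n, n + 1 ≤ T →
      ∑ θ ∈ Finset.Icc 1 (n + 1), jumpProb T μ q θ = 1 - μ * (1 - q) ^ n := by
    intro n
    induction n with
    | zero => intro _; simp [jumpProb]
    | succ n ih =>
      intro hn
      rw [Finset.sum_Icc_succ_top (by omega), ih (by omega)]
      unfold jumpProb
      rw [if_neg (by omega), if_pos (by omega), show n + 1 + 1 - 2 = n by omega]
      ring
  obtain ⟨n, rfl⟩ : ∃ n, T = n + 1 := ⟨T - 1, by omega⟩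
  rw [Finset.sum_Icc_succ_top (by omega), key n le_rfl]
  simp [jumpProb]

lemma probLE_eq (t : ℕ) : probLE T μ q t =
    ∑ θ ∈ Finset.Icc 1 (T + 1), jumpProb T μ q θ * if θ ≤ t then 1 else 0 := by
  simp [probLE, Finset.sum_filter]

lemma probGT_eq (t : ℕ) : probGT T μ q t =
    ∑ θ ∈ Finset.Icc 1 (T + 1), jumpProb T μ q θ * if t < θ then 1 else 0 := by
  simp [probGT, Finset.sum_filter]

lemma probLE_add_probGT (hT : 1 ≤ T) (t : ℕ) : probLE T μ q t + probGT T μ q t = 1 := by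
  rw [← sum_jumpProb (μ := μ) (q := q) hT,
    ← Finset.sum_filter_add_sum_filter_not (Finset.Icc 1 (T + 1)) (fun θ => θ ≤ t)]
  simp [probLE, probGT]

lemma probLE_nonneg (hp : ∀ θ, 0 ≤ jumpProb T μ q θ) (t : ℕ) : 0 ≤ probLE T μ q t :=
  Finset.sum_nonneg fun _ _ => hp _

lemma probGT_nonneg (hp : ∀ θ, 0 ≤ jumpProb T μ q θ) (t : ℕ) : 0 ≤ probGT T μ q t :=
  Finset.sum_nonneg fun _ _ => hp _

lemma probLE_mono (hp : ∀ θ, 0 ≤ jumpProb T μ q θ) : Monotone (probLE T μ q) := by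
  intro a b hab
  refine Finset.sum_le_sum_of_subset_of_nonneg ?_ fun _ _ _ => hp _
  intro θ
  simp only [Finset.mem_filter]
  exact fun h => ⟨h.1, h.2.trans hab⟩

lemma jumpProb_le_probLE (hp : ∀ θ, 0 ≤ jumpProb T μ q θ) {θ t : ℕ} (h1 : 1 ≤ θ)
    (h2 : θ ≤ T + 1) (h3 : θ ≤ t) : jumpProb T μ q θ ≤ probLE T μ q t :=
  Finset.single_le_sum (f := jumpProb T μ q) (fun _ _ => hp _) (by simp [h1, h2, h3])

lemma jumpProb_le_probGT (hp : ∀ θ, 0 ≤ jumpProb T μ q θ) {θ t : ℕ} (h1 : 1 ≤ θ)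
    (h2 : θ ≤ T + 1) (h3 : t < θ) : jumpProb T μ q θ ≤ probGT T μ q t :=
  Finset.single_le_sum (f := jumpProb T μ q) (fun _ _ => hp _) (by simp [h1, h2, h3])

end law

/-! ### Obedience and utility as linear conditions -/

section general
variable {T : ℕ} {μ q : ℝ} {c : ℝ} (ρ : Mechanism)

lemma expect_eq (f : ℕ → (Fin T → Message) → ℝ) : expect T μ q ρ f =
    ∑ θ ∈ Finset.Icc 1 (T + 1), jumpProb T μ q θ *
      ∑ m : Fin T → Message, (∏ i : Fin T, ρ.msgProb θ (history m i) (m i)) * f θ m := by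
  simp only [expect, pathProb, Finset.mul_sum, mul_assoc]

lemma expect_sub (f g : ℕ → (Fin T → Message) → ℝ) :
    expect T μ q ρ f - expect T μ q ρ g = expect T μ q ρ (fun θ m => f θ m - g θ m) := by
  simp only [expect, mul_sub, Finset.sum_sub_distrib]

lemma expect_congr {f g : ℕ → (Fin T → Message) → ℝ}
    (h : ∀ θ ∈ Finset.Icc 1 (T + 1), ∀ m, f θ m = g θ m) :
    expect T μ q ρ f = expect T μ q ρ g :=
  Finset.sum_congr rfl fun θ hθ => Finset.sum_congr rfl fun m _ => by rw [h θ hθ m]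

lemma prob_silentUpTo {l : ℕ} (hl : l ≤ T) : prob T μ q ρ (silentUpTo T l) =
    ∑ θ ∈ Finset.Icc 1 (T + 1), jumpProb T μ q θ * ρ.surv θ l := by
  rw [prob, expect_eq]
  refine Finset.sum_congr rfl fun θ _ => ?_
  rw [← sum_msgProb_silentInd ρ θ l hl]
  rfl

/-- The probability that the jump has occurred by time `l` and only silence was recommended. -/
noncomputable def silentBad (T : ℕ) (μ q : ℝ) (ρ : Mechanism) (l : ℕ) : ℝ :=
  ∑ θ ∈ Finset.Icc 1 (T + 1), jumpProb T μ q θ * if θ ≤ l then ρ.surv θ l else 0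

/-- The probability that the jump occurs after time `t` and only silence is recommended before
it. -/
noncomputable def silentJump (T : ℕ) (μ q : ℝ) (ρ : Mechanism) (t : ℕ) : ℝ :=
  ∑ θ ∈ Finset.Icc 1 (T + 1), jumpProb T μ q θ * if t < θ then ρ.surv θ (θ - 1) else 0

/-- The probability that the state at time `l` is good and only silence was recommended. -/
noncomputable def silentGood (T : ℕ) (μ q : ℝ) (ρ : Mechanism) (l : ℕ) : ℝ :=
  ∑ θ ∈ Finset.Icc 1 (T + 1), jumpProb T μ q θ * if l < θ then ρ.surv θ l else 0

-- Averages `gain_eq`. Both sides of the silence constraint are divided by the same probability, so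
-- this unnormalized difference decides it.
open Classical in
lemma expect_gain {t : ℕ} (ht : t ≤ T) :
    expect T μ q ρ (fun θ m => if m ∈ silentUpTo T t then contCost c t t θ else 0) -
      expect T μ q ρ (fun θ m => if m ∈ silentUpTo T t then
        contCost c t (obeyTime m (t + 1)) θ else 0) =
    silentJump T μ q ρ t - c * ∑ l ∈ Finset.Icc t T, silentBad T μ q ρ l := by
  rw [expect_sub, expect_congr ρ fun θ hθ m => gain_eq c m ht (Finset.mem_Icc.1 hθ).2]
  have h2 : ∑ l ∈ Finset.Icc t T, silentBad T μ q ρ l = ∑ θ ∈ Finset.Icc 1 (T + 1),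
      jumpProb T μ q θ * ∑ l ∈ Finset.Icc t T, if θ ≤ l then ρ.surv θ l else 0 := by
    unfold silentBad
    rw [Finset.sum_comm]
    simp only [Finset.mul_sum]
  rw [h2, expect_eq, silentJump, Finset.mul_sum, ← Finset.sum_sub_distrib]
  refine Finset.sum_congr rfl fun θ hθ => ?_
  rw [← mul_assoc, mul_comm c, mul_assoc, ← mul_sub]
  congr 1
  simp only [mul_sub, Finset.sum_sub_distrib]
  congr 1
  · by_cases h : t < θ
    · simp only [if_pos h]
      exact sum_msgProb_silentInd ρ θ _ (by have := (Finset.mem_Icc.1 hθ).2; omega)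
    · simp [if_neg h]
  · simp only [Finset.mul_sum]
    rw [Finset.sum_comm]
    refine Finset.sum_congr rfl fun l hl => ?_
    by_cases h : θ ≤ l
    · simp only [if_pos h]
      rw [← sum_msgProb_silentInd ρ θ l (Finset.mem_Icc.1 hl).2, Finset.mul_sum]
      exact Finset.sum_congr rfl fun m _ => by ring
    · simp [if_neg h]

lemma utility_eq : utility T μ q ρ =
    ∑ l ∈ Finset.Icc 1 T, (silentBad T μ q ρ l + silentGood T μ q ρ l) := by
  have h1 : ∀ l, silentBad T μ q ρ l + silentGood T μ q ρ l =
      ∑ θ ∈ Finset.Icc 1 (T + 1), jumpProb T μ q θ * ρ.surv θ l := by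
    intro l
    rw [silentBad, silentGood, ← Finset.sum_add_distrib]
    refine Finset.sum_congr rfl fun θ _ => ?_
    rw [← mul_add]
    by_cases h : θ ≤ l
    · simp [h, not_lt.2 h]
    · simp [h, not_le.1 h]
  simp only [h1, utility, obeyTime_one_sub_one, expect_eq]
  rw [Finset.sum_comm]
  refine Finset.sum_congr rfl fun θ _ => ?_
  rw [← Finset.mul_sum]
  congr 1
  simp only [Finset.mul_sum]
  rw [Finset.sum_comm]
  exact Finset.sum_congr rfl fun l hl => sum_msgProb_silentInd ρ θ l (Finset.mem_Icc.1 hl).2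

lemma silentBad_le (hp : ∀ θ, 0 ≤ jumpProb T μ q θ) (l : ℕ) :
    silentBad T μ q ρ l ≤ probLE T μ q l := by
  rw [silentBad, probLE_eq]
  refine Finset.sum_le_sum fun θ _ => mul_le_mul_of_nonneg_left ?_ (hp θ)
  split_ifs
  exacts [ρ.surv_le_one _ _, le_rfl]

lemma silentGood_le (hp : ∀ θ, 0 ≤ jumpProb T μ q θ) (l : ℕ) :
    silentGood T μ q ρ l ≤ probGT T μ q l := by
  rw [silentGood, probGT_eq]
  refine Finset.sum_le_sum fun θ _ => mul_le_mul_of_nonneg_left ?_ (hp θ)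
  split_ifs
  exacts [ρ.surv_le_one _ _, le_rfl]

lemma silentJump_le (hp : ∀ θ, 0 ≤ jumpProb T μ q θ) (l : ℕ) :
    silentJump T μ q ρ l ≤ probGT T μ q l := by
  rw [silentJump, probGT_eq]
  refine Finset.sum_le_sum fun θ _ => mul_le_mul_of_nonneg_left ?_ (hp θ)
  split_ifs
  exacts [ρ.surv_le_one _ _, le_rfl]

variable {ρ}

/-- Obedience says nothing after a null event, but the linear inequality survives there: the tail of
`silentBad` vanishes because survival probabilities decrease in time. -/
lemma Obedient.silent_le (hρ : Obedient T μ q c ρ) (hp : ∀ θ, 0 ≤ jumpProb T μ q θ) {t : ℕ}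
    (h1 : 1 ≤ t) (h2 : t ≤ T) :
    c * ∑ l ∈ Finset.Icc t T, silentBad T μ q ρ l ≤ silentJump T μ q ρ t := by
  classical
  have hnn : ∀ θ ∈ Finset.Icc 1 (T + 1), 0 ≤ jumpProb T μ q θ * ρ.surv θ t :=
    fun θ _ => mul_nonneg (hp θ) (ρ.surv_nonneg _ _)
  have hP := prob_silentUpTo (μ := μ) (q := q) ρ h2
  rcases (Finset.sum_nonneg hnn).lt_or_eq with h | h
  · rw [← hP] at h
    have := (hρ t h1 h2).1 h
    unfold condExpect at this
    have := (div_le_div_iff_of_pos_right h).1 this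
    rw [← sub_nonneg]
    rw [← expect_gain ρ h2]
    exact sub_nonneg.2 this
  · have hz := (Finset.sum_eq_zero_iff_of_nonneg hnn).1 h.symm
    have hb : ∀ l ∈ Finset.Icc t T, silentBad T μ q ρ l = 0 := by
      intro l hl
      refine Finset.sum_eq_zero fun θ hθ => ?_
      rcases mul_eq_zero.1 (hz θ hθ) with h0 | h0
      · rw [h0, zero_mul]
      · have := ρ.surv_antitone θ (Finset.mem_Icc.1 hl).1
        rw [h0] at this
        rw [le_antisymm this (ρ.surv_nonneg _ _), ite_self, mul_zero]
    rw [Finset.sum_eq_zero hb, mul_zero]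
    refine Finset.sum_nonneg fun θ _ => mul_nonneg (hp θ) ?_
    split_ifs
    exacts [ρ.surv_nonneg _ _, le_rfl]

lemma history_of_silent {m : Fin T → Message} {i : ℕ} (hi : i ≤ T) (hm : m ∈ silentUpTo T i) :
    history m i = silentHistory i := by
  unfold history silentHistory
  refine List.ext_getElem (by simp [hi]) fun j hj _ => ?_
  simp only [List.length_take, List.length_ofFn, lt_min_iff] at hj
  simp only [List.getElem_take, List.getElem_ofFn, List.getElem_replicate]
  exact hm ⟨j, hj.2⟩ (by simpa using hj.1)

/-- A mechanism that recommends declaring only in the bad state is obedient if the silence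
constraints hold: the declare constraints are automatic. -/
lemma obedient_of_silent_le (hp : ∀ θ, 0 ≤ jumpProb T μ q θ) (hc : 0 ≤ c)
    (hg : ∀ h : List Message, h.length < T → ρ.good h = 1)
    (hs : ∀ t, 1 ≤ t → t ≤ T →
      c * ∑ l ∈ Finset.Icc t T, silentBad T μ q ρ l ≤ silentJump T μ q ρ t) :
    Obedient T μ q c ρ := by
  classical
  intro t h1 h2
  refine ⟨fun h => ?_, fun h => ?_⟩
  · unfold condExpect
    refine div_le_div_of_nonneg_right ?_ h.le
    have := hs t h1 h2
    rw [← sub_nonneg, ← expect_gain ρ h2] at this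
    exact sub_nonneg.1 this
  · unfold condExpect
    refine div_le_div_of_nonneg_right ?_ h.le
    refine Finset.sum_le_sum fun θ hθ => Finset.sum_le_sum fun m _ => ?_
    by_cases hm : m ∈ firstDeclareAt T t
    · simp only [if_pos hm]
      by_cases hθt : t < θ
      · have h0 : pathProb T μ q ρ θ m = 0 := by
          unfold pathProb
          rw [Finset.prod_eq_zero (Finset.mem_univ (⟨t - 1, by omega⟩ : Fin T)), mul_zero]
          have hist : history m (t - 1) = silentHistory (t - 1) :=
            history_of_silent (by omega) fun i hi => hm.1 i (by omega)
          have hd : m ⟨t - 1, by omega⟩ = .declare := hm.2 _ (by simp; omega)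
          simp only [hist, hd, Mechanism.msgProb]
          have hl : (silentHistory (t - 1)).length = t - 1 := by simp [silentHistory]
          have := hg (silentHistory (t - 1)) (by omega)
          rw [Mechanism.good, hl] at this
          rw [hl, min_eq_right (by omega), this, sub_self]
        simp [h0]
      · have hob := (obeyTime_spec m (t := t + 1) (by omega)).1
        refine mul_le_mul_of_nonneg_left ?_
          (mul_nonneg (hp θ) (Finset.prod_nonneg fun i _ => ρ.msgProb_nonneg _ _ _))
        rw [contCost_self, if_neg hθt, contCost_eq c (by omega), if_neg (by omega)]
        refine mul_nonneg hc (sub_nonneg.2 (Nat.cast_le.2 (by omega)))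
    · simp [if_neg hm]

/-- The expected utility is at most the expected number of periods in the good state plus that of
the silent periods in the bad state. -/
lemma utility_le (hp : ∀ θ, 0 ≤ jumpProb T μ q θ) : utility T μ q ρ ≤
    ∑ l ∈ Finset.Icc 1 T, silentBad T μ q ρ l + ∑ l ∈ Finset.Icc 1 T, probGT T μ q l := by
  rw [utility_eq, Finset.sum_add_distrib]
  exact add_le_add_right (Finset.sum_le_sum fun l _ => silentGood_le ρ hp l) _

end general

/-! ### Threshold mechanisms -/

section threshold
variable {T : ℕ} {μ q c : ℝ} {ρ : Mechanism} {n : ℕ} {r : ℝ}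

/-- After `i` messages the time is `i + 1`, so `min θ (i + 2)` equals `i + 2` exactly in the good
state. -/
lemma HasThreshold.silence_eq (h : HasThreshold T ρ n r) {θ i : ℕ} (hθ : 1 ≤ θ) (hi : i < T) :
    ρ.silence (min θ (i + 2)) (silentHistory i) =
      if i + 1 < θ then 1 else if i + 1 < n then 1 else if i + 1 = n then r else 0 := by
  have hl : (silentHistory i).length = i := by simp [silentHistory]
  split_ifs with h1
  · have := h.2.1 (silentHistory i) (by omega)
    rw [Mechanism.good, hl] at this
    rw [min_eq_right (by omega), this]
  all_goals
    rw [min_eq_left (by omega), h.1 _ (by omega) θ 1 hθ (by omega) le_rfl (by omega)]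
    have := h.2.2 (i + 1) (by omega) (by omega)
    rw [Nat.add_sub_cancel, Mechanism.bad] at this
    rw [this]
    simp [*]

lemma HasThreshold.surv_of_lt (h : HasThreshold T ρ n r) {θ l : ℕ} (hl : l ≤ T) (hlt : l < θ) :
    ρ.surv θ l = 1 := by
  refine Finset.prod_eq_one fun i hi => ?_
  have := Finset.mem_range.1 hi
  rw [h.silence_eq (by omega) (by omega), if_pos (by omega)]

/-- The last factor decides: up to `n` all earlier factors are one, and beyond `n` the last one is
zero. -/
lemma HasThreshold.surv_of_le (h : HasThreshold T ρ n r) {θ l : ℕ} (hθ : 1 ≤ θ) (hl : l ≤ T)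
    (hle : θ ≤ l) : ρ.surv θ l = if l < n then 1 else if l = n then r else 0 := by
  obtain ⟨k, rfl⟩ : ∃ k, l = k + 1 := ⟨l - 1, by omega⟩
  rw [Mechanism.surv, Finset.prod_range_succ, h.silence_eq hθ (by omega), if_neg (by omega)]
  by_cases hk : k + 1 ≤ n
  · rw [Finset.prod_eq_one, one_mul]
    intro i hi
    have := Finset.mem_range.1 hi
    rw [h.silence_eq hθ (by omega)]
    split_ifs <;> first | rfl | omega
  · rw [if_neg (by omega), if_neg (by omega), mul_zero]

lemma HasThreshold.silentBad_eq (h : HasThreshold T ρ n r) {l : ℕ} (hl : l ≤ T) :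
    silentBad T μ q ρ l =
      probLE T μ q l * if l < n then 1 else if l = n then r else 0 := by
  rw [silentBad, probLE_eq, Finset.sum_mul]
  refine Finset.sum_congr rfl fun θ hθ => ?_
  by_cases hle : θ ≤ l
  · rw [if_pos hle, if_pos hle, h.surv_of_le (Finset.mem_Icc.1 hθ).1 hl hle, mul_one]
  · simp [hle]

lemma HasThreshold.silentJump_eq (h : HasThreshold T ρ n r) (t : ℕ) :
    silentJump T μ q ρ t = probGT T μ q t := by
  rw [silentJump, probGT_eq]
  refine Finset.sum_congr rfl fun θ hθ => ?_
  have := Finset.mem_Icc.1 hθ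
  rw [h.surv_of_lt (θ := θ) (l := θ - 1) (by omega) (by omega)]

lemma HasThreshold.silentGood_eq (h : HasThreshold T ρ n r) {l : ℕ} (hl : l ≤ T) :
    silentGood T μ q ρ l = probGT T μ q l := by
  rw [silentGood, probGT_eq]
  refine Finset.sum_congr rfl fun θ _ => ?_
  by_cases hlt : l < θ
  · rw [h.surv_of_lt hl hlt]
  · simp [hlt]

lemma sum_mul_threshold (F : ℕ → ℝ) {t T n : ℕ} (r : ℝ) (ht : t ≤ n) (hn : n ≤ T) :
    ∑ l ∈ Finset.Icc t T, F l * (if l < n then 1 else if l = n then r else 0) =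
      ∑ l ∈ Finset.Ico t n, F l + r * F n := by
  have hsub : Finset.Icc t n ⊆ Finset.Icc t T := Finset.Icc_subset_Icc le_rfl hn
  rw [← Finset.sum_subset hsub, ← Finset.Ico_insert_right ht,
    Finset.sum_insert (by simp), add_comm]
  · congr 1
    · refine Finset.sum_congr rfl fun l hl => ?_
      rw [if_pos (Finset.mem_Ico.1 hl).2, mul_one]
    · simp [mul_comm]
  · intro l h1 h2
    simp only [Finset.mem_Icc] at h1 h2
    rw [if_neg (by omega), if_neg (by omega), mul_zero]

/-- The silence constraints of the mechanism with threshold `n` and probability `r`. -/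
def Feasible (F G : ℕ → ℝ) (c : ℝ) (n : ℕ) (r : ℝ) : Prop :=
  ∀ t, 1 ≤ t → t ≤ n → c * (∑ l ∈ Finset.Ico t n, F l + r * F n) ≤ G t

/-- Only times `t ≤ n` matter: after `n` no silence is recommended in the bad state, so the left
side of the constraint is zero. -/
lemma HasThreshold.obedient_iff (h : HasThreshold T ρ n r) (hn : n ≤ T)
    (hp : ∀ θ, 0 ≤ jumpProb T μ q θ) (hc : 0 ≤ c) :
    Obedient T μ q c ρ ↔ Feasible (probLE T μ q) (probGT T μ q) c n r := by
  have hB : ∀ t, ∑ l ∈ Finset.Icc t T, silentBad T μ q ρ l = ∑ l ∈ Finset.Icc t T,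
      probLE T μ q l * (if l < n then 1 else if l = n then r else 0) :=
    fun t => Finset.sum_congr rfl fun l hl => h.silentBad_eq (Finset.mem_Icc.1 hl).2
  constructor
  · intro ho t h1 h2
    have := ho.silent_le hp h1 (h2.trans hn)
    rwa [h.silentJump_eq, hB, sum_mul_threshold _ _ h2 hn] at this
  · intro hf
    refine obedient_of_silent_le hp hc h.2.1 fun t h1 h2 => ?_
    rw [h.silentJump_eq, hB]
    by_cases htn : t ≤ n
    · rw [sum_mul_threshold _ _ htn hn]
      exact hf t h1 htn
    · rw [Finset.sum_eq_zero, mul_zero]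
      · exact probGT_nonneg hp t
      · intro l hl
        have := Finset.mem_Icc.1 hl
        rw [if_neg (by omega), if_neg (by omega), mul_zero]

lemma HasThreshold.utility_eq (h : HasThreshold T ρ n r) (h1 : 1 ≤ n) (hn : n ≤ T) :
    utility T μ q ρ = ∑ l ∈ Finset.Ico 1 n, probLE T μ q l + r * probLE T μ q n +
      ∑ l ∈ Finset.Icc 1 T, probGT T μ q l := by
  rw [InfoDesign.utility_eq, Finset.sum_add_distrib, ← sum_mul_threshold _ _ h1 hn]
  congr 1
  · exact Finset.sum_congr rfl fun l hl => h.silentBad_eq (Finset.mem_Icc.1 hl).2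
  · exact Finset.sum_congr rfl fun l hl => h.silentGood_eq (Finset.mem_Icc.1 hl).2

lemma exists_hasThreshold (T : ℕ) {n : ℕ} {r : ℝ} (h0 : 0 ≤ r) (h1 : r ≤ 1) :
    ∃ ρ : Mechanism, HasThreshold T ρ n r := by
  refine ⟨⟨fun s h => if h.length + 2 ≤ s then 1 else if h.length + 1 < n then 1 else
    if h.length + 1 = n then r else 0, fun s h => ?_, fun s h => ?_⟩, ?_, ?_, ?_⟩
  · split_ifs <;> first | exact h0 | norm_num
  · split_ifs <;> first | exact h1 | norm_num
  · intro h _ s s' _ hs _ hs'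
    simp only
    rw [if_neg (by omega), if_neg (show ¬h.length + 2 ≤ s' by omega)]
  · intro h _
    simp [Mechanism.good]
  · intro t ht _
    simp only [Mechanism.bad, silentHistory, List.length_replicate]
    rw [if_neg (by omega), Nat.sub_add_cancel ht]

/-- The threshold is the first time at which the bad-state probability drops below one;
prioritization then forces zero at every later time. If it never drops, the pair is `(T, 1)`. -/
lemma timePrioritized_iff (hT : 1 ≤ T) : TimePrioritized T ρ ↔
    ∃ (n : ℕ) (r : ℝ), ValidPair T n r ∧ HasThreshold T ρ n r := by
  classical
  constructor
  · rintro ⟨hs, hg, hnot⟩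
    have step : ∀ t, 1 ≤ t → t + 1 ≤ T → ρ.bad (silentHistory (t - 1)) < 1 →
        ρ.bad (silentHistory t) = 0 := fun t h1 h2 h3 =>
      le_antisymm (not_lt.1 fun h => hnot ⟨t, h1, h2, h, h3⟩) (ρ.silence_nonneg _ _)
    by_cases hex : ∃ t, 1 ≤ t ∧ t ≤ T ∧ ρ.bad (silentHistory (t - 1)) < 1
    · obtain ⟨hn1, hnT, hn⟩ := Nat.find_spec hex
      set n := Nat.find hex
      refine ⟨n, ρ.bad (silentHistory (n - 1)),
        ⟨hn1, hnT, ρ.silence_nonneg _ _, ρ.silence_le_one _ _⟩, hs, hg, fun t h1 h2 => ?_⟩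
      have hafter : ∀ k, n + 1 + k ≤ T → ρ.bad (silentHistory (n + k)) = 0 := by
        intro k
        induction k with
        | zero => intro hk; exact step n hn1 hk hn
        | succ k ih =>
          intro hk
          refine step (n + k + 1) (by omega) (by omega) ?_
          rw [Nat.add_sub_cancel, ih (by omega)]
          exact zero_lt_one
      rcases lt_trichotomy t n with h | h | h
      · rw [if_pos h]
        refine le_antisymm (ρ.silence_le_one _ _) (not_lt.1 fun hlt => ?_)
        exact Nat.find_min hex h ⟨h1, h2, hlt⟩
      · rw [h]; simp
      · rw [if_neg (by omega), if_neg (by omega)]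
        have := hafter (t - 1 - n) (by omega)
        rwa [show n + (t - 1 - n) = t - 1 by omega] at this
    · push Not at hex
      refine ⟨T, 1, ⟨hT, le_rfl, zero_le_one, le_rfl⟩, hs, hg, fun t h1 h2 => ?_⟩
      have : ρ.bad (silentHistory (t - 1)) = 1 :=
        le_antisymm (ρ.silence_le_one _ _) (hex t h1 h2)
      rw [this]
      split_ifs <;> first | rfl | omega
  · rintro ⟨n, r, -, hs, hg, hb⟩
    refine ⟨hs, hg, ?_⟩
    rintro ⟨t, h1, h2, h3, h4⟩
    have e1 := hb t h1 (by omega)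
    have e2 := hb (t + 1) (by omega) h2
    rw [Nat.add_sub_cancel] at e2
    rw [e1] at h4
    rw [e2] at h3
    split_ifs at h3 h4 <;> first | omega | linarith

end threshold

/-! ### The algorithm and the relaxed problem -/

section algorithm
variable {T : ℕ} {μ q c : ℝ}

lemma feasible_of_probLE_eq_zero {n : ℕ} (hp : ∀ θ, 0 ≤ jumpProb T μ q θ)
    (h0 : probLE T μ q n = 0) (r : ℝ) : Feasible (probLE T μ q) (probGT T μ q) c n r := by
  intro t _ _
  rw [h0, mul_zero, add_zero, Finset.sum_eq_zero, mul_zero]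
  · exact probGT_nonneg hp t
  · intro l hl
    exact le_antisymm (h0 ▸ probLE_mono hp (Finset.mem_Ico.1 hl).2.le) (probLE_nonneg hp l)

lemma le_div_sub_iff {F S G r : ℝ} (hc : 0 < c) (hF : 0 < F) :
    r ≤ 1 / F * (G / c - S) ↔ c * (S + r * F) ≤ G := by
  rw [one_div, inv_mul_eq_div, le_div_iff₀ hF, le_sub_iff_add_le, le_div_iff₀ hc]
  constructor <;> intro h <;> linarith

/-- Each term of the minimum is one silence constraint solved for `r`. When `P(θ ≤ n) = 0` the
constraints do not involve `r` and hold, matching the value `⊤`. -/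
lemma coe_le_roundValue_iff {n : ℕ} (hp : ∀ θ, 0 ≤ jumpProb T μ q θ) (hc : 0 < c) (r : ℝ) :
    (r : EReal) ≤ roundValue T μ q c n ↔ Feasible (probLE T μ q) (probGT T μ q) c n r := by
  by_cases h0 : probLE T μ q n = 0
  · simp only [feasible_of_probLE_eq_zero hp h0, iff_true]
    exact Finset.le_inf fun t _ => by rw [if_pos h0]; exact le_top
  · have hF : 0 < probLE T μ q n := lt_of_le_of_ne (probLE_nonneg hp n) (Ne.symm h0)
    simp only [roundValue, if_neg h0, Finset.le_inf_iff, Finset.mem_Icc, EReal.coe_le_coe_iff,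
      le_div_sub_iff hc hF, Feasible, and_imp]

/-- A value below one excludes `⊤`, and the constraint at a minimizing `t` is then an equality. -/
lemma exists_binding {n : ℕ} (hp : ∀ θ, 0 ≤ jumpProb T μ q θ) (hc : 0 < c)
    (hlt : roundValue T μ q c n < 1) (hn : 1 ≤ n) :
    ∃ r : ℝ, roundValue T μ q c n = r ∧ 0 < probLE T μ q n ∧ ∃ t, 1 ≤ t ∧ t ≤ n ∧
      c * (∑ l ∈ Finset.Ico t n, probLE T μ q l + r * probLE T μ q n) = probGT T μ q t := by
  by_cases h0 : probLE T μ q n = 0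
  · have : ((1 : ℝ) : EReal) ≤ roundValue T μ q c n :=
      (coe_le_roundValue_iff hp hc 1).2 (feasible_of_probLE_eq_zero hp h0 1)
    exact absurd hlt (not_lt.2 (by simpa using this))
  · have hF : 0 < probLE T μ q n := lt_of_le_of_ne (probLE_nonneg hp n) (Ne.symm h0)
    obtain ⟨t, ht, he⟩ := Finset.exists_mem_eq_inf (Finset.Icc 1 n)
      (Finset.nonempty_Icc.2 hn) fun t =>
      if probLE T μ q n = 0 then (⊤ : EReal)
      else ((1 / probLE T μ q n *
        (probGT T μ q t / c - ∑ l ∈ Finset.Ico t n, probLE T μ q l) : ℝ) : EReal)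
    rw [if_neg h0] at he
    refine ⟨_, he, hF, t, (Finset.mem_Icc.1 ht).1, (Finset.mem_Icc.1 ht).2, ?_⟩
    field_simp
    ring

lemma algorithmLoop_spec (k : ℕ) : ∀ n, (∀ m, 1 ≤ m → m < n → 1 ≤ roundValue T μ q c m) →
    let p := algorithmLoop T μ q c k n
    n ≤ p.1 ∧ p.1 ≤ n + k ∧ p.2 = roundValue T μ q c p.1 ∧
      (∀ m, 1 ≤ m → m < p.1 → 1 ≤ roundValue T μ q c m) ∧ (p.1 < n + k → p.2 < 1) := by
  induction k with
  | zero => intro n hn; exact ⟨le_rfl, le_rfl, rfl, hn, fun h => absurd h (lt_irrefl _)⟩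
  | succ k ih =>
    intro n hn
    simp only [algorithmLoop]
    split_ifs with h
    · exact ⟨le_rfl, by omega, rfl, hn, fun _ => h⟩
    · obtain ⟨h1, h2, h3, h4, h5⟩ := ih (n + 1) fun m hm1 hm2 => by
        rcases Nat.lt_succ_iff_lt_or_eq.1 hm2 with h' | rfl
        · exact hn m hm1 h'
        · exact not_lt.1 h
      exact ⟨by omega, by omega, h3, h4, fun h' => h5 (by omega)⟩

/-- The pair returned by the algorithm is feasible, and either silence is always recommended or
one of the constraints is binding. -/
lemma algorithm_spec (hT : 1 ≤ T) (hp : ∀ θ, 0 ≤ jumpProb T μ q θ) (hc : 0 < c) :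
    ValidPair T (algThreshold T μ q c) (algProb T μ q c) ∧
    Feasible (probLE T μ q) (probGT T μ q) c (algThreshold T μ q c) (algProb T μ q c) ∧
    ((algThreshold T μ q c = T ∧ algProb T μ q c = 1) ∨
      (algProb T μ q c < 1 ∧ 0 < probLE T μ q (algThreshold T μ q c) ∧
        ∃ t, 1 ≤ t ∧ t ≤ algThreshold T μ q c ∧
          c * (∑ l ∈ Finset.Ico t (algThreshold T μ q c), probLE T μ q l +
            algProb T μ q c * probLE T μ q (algThreshold T μ q c)) = probGT T μ q t)) := by
  obtain ⟨h1, h2, h3, h4, h5⟩ := algorithmLoop_spec (T := T) (μ := μ) (q := q) (c := c) (T - 1) 1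
    fun m hm1 hm2 => by omega
  rw [show 1 + (T - 1) = T by omega] at h2 h5
  have hQ : algProb T μ q c = (min (algorithmLoop T μ q c (T - 1) 1).2 1).toReal := rfl
  change 1 ≤ algThreshold T μ q c at h1
  change algThreshold T μ q c ≤ T at h2
  change algThreshold T μ q c < T → _ at h5
  change _ = roundValue T μ q c (algThreshold T μ q c) at h3
  change ∀ m, 1 ≤ m → m < algThreshold T μ q c → _ at h4
  rw [h3] at hQ h5
  generalize algThreshold T μ q c = N at *
  generalize algProb T μ q c = Q at *
  have hm : ∀ m, 1 ≤ m → m < N → Feasible (probLE T μ q) (probGT T μ q) c m 1 :=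
    fun m hm1 hm2 => (coe_le_roundValue_iff hp hc 1).1 (by simpa using h4 m hm1 hm2)
  -- The pairs `(N, 0)` and `(N - 1, 1)` impose the same constraints for `t < N`. This gives a
  -- nonnegative returned probability.
  have hz : Feasible (probLE T μ q) (probGT T μ q) c N 0 := by
    intro t ht1 ht2
    rw [zero_mul, add_zero]
    rcases ht2.lt_or_eq with hlt | rfl
    · have := hm (N - 1) (by omega) (by omega) t ht1 (by omega)
      rw [one_mul, ← Finset.sum_Ico_succ_top (by omega), Nat.sub_add_cancel h1] at this
      exact this
    · simpa using probGT_nonneg hp t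
  rcases lt_or_ge (roundValue T μ q c N) 1 with hlt | hge
  · obtain ⟨r, hr, hF, ht⟩ := exists_binding hp hc hlt h1
    have hQr : Q = r := by rw [hQ, min_eq_left hlt.le, hr, EReal.toReal_coe]
    subst hQr
    have hf := (coe_le_roundValue_iff (n := N) hp hc Q).1 hr.ge
    have hQ0 : 0 ≤ Q := by
      have := (coe_le_roundValue_iff (n := N) hp hc 0).2 hz
      rw [hr] at this
      exact EReal.coe_le_coe_iff.1 this
    have hQ1 : Q < 1 := by
      rw [hr] at hlt
      exact_mod_cast hlt
    exact ⟨⟨h1, h2, hQ0, hQ1.le⟩, hf, Or.inr ⟨hQ1, hF, ht⟩⟩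
  · have hQ1 : Q = 1 := by rw [hQ, min_eq_right hge, EReal.toReal_one]
    have hN : N = T := by
      by_contra hne
      exact absurd (h5 (by omega)) (not_lt.2 hge)
    have hf := (coe_le_roundValue_iff (n := N) hp hc 1).1 (by simpa using hge)
    subst hQ1
    exact ⟨⟨h1, h2, zero_le_one, le_rfl⟩, hf, Or.inl ⟨hN, rfl⟩⟩

/-- The probability-weighted number of periods with silence in the bad state. -/
noncomputable def silentValue (F : ℕ → ℝ) (n : ℕ) (r : ℝ) : ℝ :=
  ∑ l ∈ Finset.Ico 1 n, F l + r * F n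

/-- Split the sum at the tight `t`: before it `B ≤ F`, which the algorithm attains, and from it on
the constraint caps the tail at the algorithm's own tail. -/
lemma sum_le_silentValue_algorithm (hT : 1 ≤ T) (hp : ∀ θ, 0 ≤ jumpProb T μ q θ) (hc : 0 < c)
    {B : ℕ → ℝ} (hB : ∀ l, B l ≤ probLE T μ q l)
    (hG : ∀ t, 1 ≤ t → t ≤ T → c * ∑ l ∈ Finset.Icc t T, B l ≤ probGT T μ q t) :
    ∑ l ∈ Finset.Icc 1 T, B l ≤
      silentValue (probLE T μ q) (algThreshold T μ q c) (algProb T μ q c) := by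
  obtain ⟨⟨h1, h2, -, -⟩, -, ⟨hN, hQ⟩ | ⟨-, -, t, ht1, ht2, hb⟩⟩ :=
    algorithm_spec (T := T) (μ := μ) (q := q) (c := c) hT hp hc
  · rw [hN, hQ, silentValue, one_mul, ← Finset.sum_Ico_succ_top hT]
    exact Finset.sum_le_sum fun l _ => hB l
  · have hle := hG t ht1 (ht2.trans h2)
    rw [← hb] at hle
    have hle := le_of_mul_le_mul_left hle hc
    have e1 : ∑ l ∈ Finset.Icc 1 T, B l =
        ∑ l ∈ Finset.Ico 1 t, B l + ∑ l ∈ Finset.Icc t T, B l :=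
      (Finset.sum_Ico_consecutive B ht1 (by omega : t ≤ T + 1)).symm
    have e2 := Finset.sum_Ico_consecutive (probLE T μ q) ht1 ht2
    rw [e1, silentValue, ← e2, add_assoc]
    exact add_le_add (Finset.sum_le_sum fun l _ => hB l) hle

/-- A larger pair would strictly raise the left side of the tight constraint, since `F` is positive
at the returned threshold. -/
lemma Feasible.le_algorithm (hT : 1 ≤ T) (hp : ∀ θ, 0 ≤ jumpProb T μ q θ) (hc : 0 < c)
    {n : ℕ} {r : ℝ} (hv : ValidPair T n r)
    (hf : Feasible (probLE T μ q) (probGT T μ q) c n r) :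
    (n : ℝ) + r ≤ (algThreshold T μ q c : ℝ) + algProb T μ q c := by
  obtain ⟨⟨h1, h2, hQ0, -⟩, -, ⟨hN, hQ⟩ | ⟨hQ1, hF, t, ht1, ht2, hb⟩⟩ :=
    algorithm_spec (T := T) (μ := μ) (q := q) (c := c) hT hp hc
  · rw [hN, hQ]
    exact add_le_add (Nat.cast_le.2 hv.2.1) hv.2.2.2
  · rcases lt_trichotomy n (algThreshold T μ q c) with h | h | h
    · have : (n : ℝ) + 1 ≤ algThreshold T μ q c := by exact_mod_cast h
      linarith [hv.2.2.2]
    · have := hf t ht1 (h ▸ ht2)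
      rw [← hb, h] at this
      have := le_of_mul_le_mul_left this hc
      have := le_of_mul_le_mul_right (le_of_add_le_add_left this) hF
      rw [h]
      linarith
    · exfalso
      have := hf t ht1 (by omega)
      rw [← hb] at this
      have := le_of_mul_le_mul_left this hc
      rw [← Finset.sum_Ico_consecutive (probLE T μ q) ht2 h.le,
        Finset.sum_eq_sum_Ico_succ_bot h] at this
      have h3 : 0 ≤ ∑ l ∈ Finset.Ico (algThreshold T μ q c + 1) n, probLE T μ q l :=
        Finset.sum_nonneg fun l _ => probLE_nonneg hp l
      have h4 := mul_nonneg hv.2.2.1 (probLE_nonneg hp n)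
      have h5 := mul_lt_mul_of_pos_right hQ1 hF
      linarith

/-- `silentValue` depends on `(n, r)` only through `n + r`, and grows with it as soon as
`F n > 0`. -/
lemma silentValue_mono {F : ℕ → ℝ} (hF : ∀ n, 0 ≤ F n) {n n' : ℕ} {r r' : ℝ} (hn : 1 ≤ n)
    (hn' : 1 ≤ n') (h1 : r ≤ 1) (h0' : 0 ≤ r') (hle : (n : ℝ) + r ≤ n' + r')
    (h1' : r' ≤ 1) (h0 : 0 ≤ r) :
    silentValue F n r ≤ silentValue F n' r' := by
  unfold silentValue
  rcases lt_trichotomy n n' with h | h | h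
  · rw [← Finset.sum_Ico_consecutive F hn h.le, Finset.sum_eq_sum_Ico_succ_bot h]
    have a := Finset.sum_nonneg fun l (_ : l ∈ Finset.Ico (n + 1) n') => hF l
    have b := mul_nonneg h0' (hF n')
    have d := mul_le_mul_of_nonneg_right h1 (hF n)
    linarith
  · subst h
    have := mul_le_mul_of_nonneg_right (show r ≤ r' by linarith) (hF n)
    linarith
  · have hc : (n' : ℝ) + 1 ≤ n := by exact_mod_cast h
    have hr : r = 0 := by linarith
    have hr' : r' = 1 := by linarith
    have hnn : n = n' + 1 := by
      have : (n : ℝ) ≤ n' + 1 := by linarith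
      have : n ≤ n' + 1 := by exact_mod_cast this
      omega
    subst hr hr' hnn
    rw [Finset.sum_Ico_succ_top hn']
    linarith

lemma silentValue_strictMono {F : ℕ → ℝ} (hF : ∀ n, 0 ≤ F n) (hmono : Monotone F) {n n' : ℕ}
    {r r' : ℝ} (hn : 1 ≤ n) (h0 : 0 ≤ r) (h1 : r ≤ 1) (h0' : 0 ≤ r') (h1' : r' ≤ 1)
    (hlt : (n : ℝ) + r < n' + r') (hpos : 0 < F n) :
    silentValue F n r < silentValue F n' r' := by
  unfold silentValue
  rcases lt_trichotomy n n' with h | h | h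
  · rw [← Finset.sum_Ico_consecutive F hn h.le, Finset.sum_eq_sum_Ico_succ_bot h]
    have a := Finset.sum_nonneg fun l (_ : l ∈ Finset.Ico (n + 1) n') => hF l
    have b := mul_nonneg h0' (hF n')
    have d := mul_le_mul_of_nonneg_right h1 (hF n)
    rcases h1.lt_or_eq with e | rfl
    · have := mul_lt_mul_of_pos_right e hpos
      linarith
    · rcases h0'.lt_or_eq with e' | rfl
      · have := mul_pos e' (hpos.trans_le (hmono h.le))
        linarith
      · have hlt2 : n + 1 < n' := by
          have : (n : ℝ) + 1 < n' := by linarith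
          exact_mod_cast this
        rw [Finset.sum_eq_sum_Ico_succ_bot hlt2]
        have a := Finset.sum_nonneg fun l (_ : l ∈ Finset.Ico (n + 1 + 1) n') => hF l
        have := hpos.trans_le (hmono (Nat.le_succ n))
        simp only [Nat.succ_eq_add_one] at this
        linarith
  · subst h
    have := mul_lt_mul_of_pos_right (show r < r' by linarith) hpos
    linarith
  · have hc : (n' : ℝ) + 1 ≤ n := by exact_mod_cast h
    linarith

end algorithm

/-! ### Optimality and its converse -/

section optimality
variable {T : ℕ} {μ q c : ℝ} {ρ : Mechanism}

lemma utility_le_of_algorithm (hT : 1 ≤ T) (hp : ∀ θ, 0 ≤ jumpProb T μ q θ) (hc : 0 < c)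
    (hρ : Obedient T μ q c ρ) : utility T μ q ρ ≤
      silentValue (probLE T μ q) (algThreshold T μ q c) (algProb T μ q c) +
        ∑ l ∈ Finset.Icc 1 T, probGT T μ q l := by
  refine (utility_le hp).trans (add_le_add_left ?_ _)
  exact sum_le_silentValue_algorithm hT hp hc (silentBad_le ρ hp)
    fun t h1 h2 => (hρ.silent_le hp h1 h2).trans (silentJump_le ρ hp t)

/-- A threshold mechanism is optimal if its pair is at least as large as the pair returned by the
algorithm. -/
lemma HasThreshold.isOptimal (hT : 1 ≤ T) (hp : ∀ θ, 0 ≤ jumpProb T μ q θ) (hc : 0 < c)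
    {n : ℕ} {r : ℝ} (hv : ValidPair T n r) (h : HasThreshold T ρ n r)
    (ho : Obedient T μ q c ρ)
    (hle : (algThreshold T μ q c : ℝ) + algProb T μ q c ≤ n + r) :
    IsOptimal T μ q c ρ := by
  obtain ⟨⟨h1, -, hQ0, hQ1⟩, -⟩ := algorithm_spec (T := T) (μ := μ) (q := q) (c := c) hT hp hc
  refine ⟨ho, fun ρ' ho' => (utility_le_of_algorithm hT hp hc ho').trans ?_⟩
  rw [h.utility_eq hv.1 hv.2.1]
  exact add_le_add_left (silentValue_mono (probLE_nonneg hp) h1 hv.1 hQ1 hv.2.2.1 hle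
    hv.2.2.2 hQ0) _

/-- With no jump at time one, a small probability `ε` of silence in the bad state at time two is
feasible, since `P(θ > 2) > 0`. -/
lemma two_lt_algorithm (hp : ∀ θ, 0 ≤ jumpProb T μ q θ) (hc : 0 < c) (hT : 2 ≤ T)
    (h1 : probLE T μ q 1 = 0) (h2 : 0 < probGT T μ q 2) :
    (2 : ℝ) < (algThreshold T μ q c : ℝ) + algProb T μ q c := by
  set ε := min 1 (probGT T μ q 2 / c) with hε
  have hε0 : 0 < ε := lt_min zero_lt_one (div_pos h2 hc)
  have hF2 : probLE T μ q 2 ≤ 1 := by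
    have := probLE_add_probGT (μ := μ) (q := q) (show 1 ≤ T by omega) 2
    linarith
  have hb : c * (ε * probLE T μ q 2) ≤ probGT T μ q 2 := by
    have a : ε * probLE T μ q 2 ≤ probGT T μ q 2 / c :=
      (mul_le_of_le_one_right hε0.le hF2).trans (min_le_right _ _)
    rwa [le_div_iff₀ hc, mul_comm] at a
  have hG : probGT T μ q 2 ≤ probGT T μ q 1 := by
    have a := probLE_add_probGT (μ := μ) (q := q) (show 1 ≤ T by omega) 2
    have b := probLE_add_probGT (μ := μ) (q := q) (show 1 ≤ T by omega) 1
    have := probLE_mono hp (show 1 ≤ 2 by omega)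
    linarith
  have hf : Feasible (probLE T μ q) (probGT T μ q) c 2 ε := by
    intro t ht1 ht2
    interval_cases t
    · simpa [h1] using hb.trans hG
    · simpa using hb
  have := hf.le_algorithm (by omega) hp hc ⟨by omega, hT, hε0.le, min_le_left _ _⟩
  push_cast at this
  linarith

lemma silentValue_lt_algorithm (hT : 1 ≤ T) (hp : ∀ θ, 0 ≤ jumpProb T μ q θ) (hc : 0 < c)
    (hμ1 : μ ≤ 1) (hdeg : μ < 1 ∨ (0 < q ∧ q < 1 ∧ 2 ≤ T)) {n : ℕ} {r : ℝ}
    (hv : ValidPair T n r)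
    (hlt : (n : ℝ) + r < (algThreshold T μ q c : ℝ) + algProb T μ q c) :
    silentValue (probLE T μ q) n r <
      silentValue (probLE T μ q) (algThreshold T μ q c) (algProb T μ q c) := by
  obtain ⟨⟨-, -, hQ0, hQ1⟩, -⟩ := algorithm_spec (T := T) (μ := μ) (q := q) (c := c) hT hp hc
  have strict : 0 < probLE T μ q n → _ := silentValue_strictMono (probLE_nonneg hp)
    (probLE_mono hp) hv.1 hv.2.2.1 hv.2.2.2 hQ0 hQ1 hlt
  rcases hμ1.lt_or_eq with hμ | rfl
  · refine strict (lt_of_lt_of_le ?_ (jumpProb_le_probLE hp le_rfl (by omega) hv.1))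
    simp [jumpProb, hμ]
  · obtain ⟨hq0, hq1, hT2⟩ := hdeg.resolve_left (lt_irrefl _)
    have hF2 : 0 < probLE T 1 q 2 := by
      refine lt_of_lt_of_le ?_ (jumpProb_le_probLE hp one_le_two (by omega) le_rfl)
      simp [jumpProb, hT2, hq0]
    rcases hv.1.lt_or_eq with h | h
    · exact strict (hF2.trans_le (probLE_mono hp h))
    · have hF1 : probLE T 1 q 1 = 0 := by
        rw [probLE_eq]
        refine Finset.sum_eq_zero fun θ hθ => ?_
        have := (Finset.mem_Icc.1 hθ).1
        by_cases h' : θ ≤ 1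
        · rw [show θ = 1 by omega]; simp [jumpProb]
        · simp [h']
      have hG2 : 0 < probGT T 1 q 2 := by
        refine lt_of_lt_of_le ?_ (jumpProb_le_probGT hp (show 1 ≤ T + 1 by omega) le_rfl
          (by omega))
        have : 0 < 1 - q := by linarith
        unfold jumpProb
        rw [if_neg (by omega), if_neg (by omega), if_pos rfl]
        positivity
      -- Since `F 1 = 0`, the pair `(1, r)` has the value of `(2, 0)`, from which strict
      -- monotonicity applies.
      have := silentValue_strictMono (n := 2) (r := 0) (probLE_nonneg hp) (probLE_mono hp)
        one_le_two le_rfl zero_le_one hQ0 hQ1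
        (by simpa using two_lt_algorithm hp hc hT2 hF1 hG2) hF2
      subst h
      simpa [silentValue, hF1] using this

end optimality

end InfoDesign

theorem theorem1 (T : ℕ) (hT : 1 ≤ T) (μ q c : ℝ)
    (hμ0 : 0 ≤ μ) (hμ1 : μ ≤ 1) (hq0 : 0 ≤ q) (hq1 : q ≤ 1) (hc : 0 < c) :
    -- restriction to time-based prioritized mechanisms is without loss of optimality
    (∀ ρ : Mechanism, Obedient T μ q c ρ →
      ∃ ρ' : Mechanism, TimePrioritized T ρ' ∧ Obedient T μ q c ρ' ∧
        utility T μ q ρ ≤ utility T μ q ρ') ∧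
    (∃ ρ : Mechanism, TimePrioritized T ρ ∧ IsOptimal T μ q c ρ) ∧
    -- these are exactly the mechanisms described by a pair `(n, r)`, and each pair describes one
    (∀ ρ : Mechanism, TimePrioritized T ρ ↔
      ∃ (n : ℕ) (r : ℝ), ValidPair T n r ∧ HasThreshold T ρ n r) ∧
    (∀ (n : ℕ) (r : ℝ), ValidPair T n r → ∃ ρ : Mechanism, HasThreshold T ρ n r) ∧
    -- a pair that maximizes `n + r` under the obedience constraints is optimal
    (∀ (n : ℕ) (r : ℝ) (ρ : Mechanism), ValidPair T n r → HasThreshold T ρ n r →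
      Obedient T μ q c ρ →
      (∀ (n' : ℕ) (r' : ℝ) (ρ' : Mechanism), ValidPair T n' r' → HasThreshold T ρ' n' r' →
        Obedient T μ q c ρ' → (n' : ℝ) + r' ≤ (n : ℝ) + r) →
      IsOptimal T μ q c ρ) ∧
    -- and conversely, unless the jump time is degenerate
    ((μ < 1 ∨ (0 < q ∧ q < 1 ∧ 2 ≤ T)) →
      ∀ (n : ℕ) (r : ℝ) (ρ : Mechanism), ValidPair T n r → HasThreshold T ρ n r →
        IsOptimal T μ q c ρ →
        ∀ (n' : ℕ) (r' : ℝ) (ρ' : Mechanism), ValidPair T n' r' → HasThreshold T ρ' n' r' →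
          Obedient T μ q c ρ' → (n' : ℝ) + r' ≤ (n : ℝ) + r) ∧
    -- the algorithm returns a maximizing pair, and its mechanism is optimal
    ValidPair T (algThreshold T μ q c) (algProb T μ q c) ∧
    (∀ (n : ℕ) (r : ℝ) (ρ : Mechanism), ValidPair T n r → HasThreshold T ρ n r →
      Obedient T μ q c ρ →
      (n : ℝ) + r ≤ (algThreshold T μ q c : ℝ) + algProb T μ q c) ∧
    (∀ ρ : Mechanism, HasThreshold T ρ (algThreshold T μ q c) (algProb T μ q c) →
      TimePrioritized T ρ ∧ IsOptimal T μ q c ρ ∧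
      utility T μ q ρ =
        (algThreshold T μ q c : ℝ) - 1
          + probLE T μ q (algThreshold T μ q c) * algProb T μ q c
          + ∑ t ∈ Finset.Icc (algThreshold T μ q c) T, probGT T μ q t) := by
  have hp : ∀ θ, 0 ≤ jumpProb T μ q θ := jumpProb_nonneg hμ0 hμ1 hq0 hq1
  obtain ⟨hv, hf, -⟩ := algorithm_spec (T := T) (μ := μ) (q := q) (c := c) hT hp hc
  have alg_obedient : ∀ ρ, HasThreshold T ρ (algThreshold T μ q c) (algProb T μ q c) →
      Obedient T μ q c ρ := fun ρ h => (h.obedient_iff hv.2.1 hp hc.le).2 hf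
  have alg_optimal : ∀ ρ, HasThreshold T ρ (algThreshold T μ q c) (algProb T μ q c) →
      TimePrioritized T ρ ∧ IsOptimal T μ q c ρ := fun ρ h =>
    ⟨(timePrioritized_iff hT).2 ⟨_, _, hv, h⟩,
      h.isOptimal hT hp hc hv (alg_obedient ρ h) le_rfl⟩
  obtain ⟨ρA, hA⟩ := exists_hasThreshold T (n := algThreshold T μ q c) hv.2.2.1 hv.2.2.2
  obtain ⟨hAt, hAo⟩ := alg_optimal ρA hA
  refine ⟨fun ρ hρ => ⟨ρA, hAt, hAo.1, hAo.2 ρ hρ⟩, ⟨ρA, hAt, hAo⟩,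
    fun ρ => timePrioritized_iff hT, fun n r h => exists_hasThreshold T h.2.2.1 h.2.2.2,
    fun n r ρ hnr h ho hmax => h.isOptimal hT hp hc hnr ho (hmax _ _ ρA hv hA hAo.1),
    fun hdeg n r ρ hnr h hopt n' r' ρ' hnr' h' ho' => ?_, hv,
    fun n r ρ hnr h ho =>
      ((h.obedient_iff hnr.2.1 hp hc.le).1 ho).le_algorithm hT hp hc hnr,
    fun ρ h => ⟨(alg_optimal ρ h).1, (alg_optimal ρ h).2, ?_⟩⟩
  · refine (((h'.obedient_iff hnr'.2.1 hp hc.le).1 ho').le_algorithm hT hp hc hnr').trans ?_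
    by_contra hlt
    have h1 := silentValue_lt_algorithm hT hp hc hμ1 hdeg hnr (not_le.1 hlt)
    have h2 := hopt.2 ρA hAo.1
    rw [h.utility_eq hnr.1 hnr.2.1, hA.utility_eq hv.1 hv.2.1] at h2
    exact absurd h1 (not_lt.2 (le_of_add_le_add_right h2))
  · rw [h.utility_eq hv.1 hv.2.1]
    have e1 : ∑ l ∈ Finset.Icc 1 T, probGT T μ q l =
        ∑ l ∈ Finset.Ico 1 (algThreshold T μ q c), probGT T μ q l +
          ∑ l ∈ Finset.Icc (algThreshold T μ q c) T, probGT T μ q l :=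
      (Finset.sum_Ico_consecutive _ hv.1 (hv.2.1.trans (Nat.le_succ T))).symm
    -- Before the threshold the bad-state and good-state terms add up to one per period.
    have e2 : ∑ l ∈ Finset.Ico 1 (algThreshold T μ q c), probLE T μ q l +
        ∑ l ∈ Finset.Ico 1 (algThreshold T μ q c), probGT T μ q l =
        (algThreshold T μ q c : ℝ) - 1 := by
      rw [← Finset.sum_add_distrib]
      simp [probLE_add_probGT hT, Nat.cast_sub hv.1]
    rw [e1]
    linarith
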